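/- Let $\rho:\{0,1\}^*\to\{0,1\}^*$ be the morphism $$0\mapsto 011011010110110011011010110,\qquad 1\mapsto 011011010110110011010110110 .$$ A finite or (one-sided) infinite word is cubefree if it has no factor $uuu$ with $u$ a nonempty finite word; a morphism is cubefree if it maps every finite cubefree word to a cubefree word. For an infinite word $w$ and a letter $a$, put $$f_a^{+}=\sup_{(w_n)}\limsup_{n\to\infty}\frac{\#_a(w_n)}{n},\qquad f_a^{-}=\inf_{(w_n)}\liminf_{n\to\infty}\frac{\#_a(w_n)}{n},$$ where $\#_a(u)$ is the number of occurrences of $a$ in $u$, and $(w_n)$ runs over all sequences such that $w_n$ is a factor of $w$ of length $n$ for every $n$. If $f_a^+=f_a^-$, the letter $a$ has a frequency in $w$, namely the common value $f_a$. Let $f_{\min}$ be the infimum of the set $S$ of all frequencies $f_0$ of the letter $0$ in infinite cubefree words over $\{0,1\}$ in which the letter $0$ has a frequency. Then $\rho$ is $27$-uniform (both letters have images of length $27$) and cubefree, and its substitution matrix $(\#_i\rho(j))_{i,j\in\{0,1\}}$ is $\begin{pmatrix}11&11\\16&16\end{pmatrix}$. It has exactly one infinite fixed point $w$; every word $\rho^n(0)$,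 $n\ge 0$, is a prefix of $w$; the word $w$ is cubefree, and its letters have the frequencies $f_0=\frac{11}{27}$ and $f_1=\frac{16}{27}$. Hence $S$ is nonempty and bounded below, so that $f_{\min}$ is a real number, the greatest lower bound of $S$, and $$f_{\min}\le\frac{11}{27}.$$ -/

import Mathlib

open Filter

namespace PowerfreeWords

variable {A B : Type*}

/-- `v` is a factor (subword) of the finite word `u`. -/
def IsFactor (v u : FreeMonoid A) : Prop :=
  ∃ x y : FreeMonoid A, u = x * v * y

/-- A finite word is `k`-powerfree if none of its factors is a `k`-power `u ^ k` of a
nonempty word `u`. -/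
def IsPowerfree (k : ℕ) (w : FreeMonoid A) : Prop :=
  ∀ u : FreeMonoid A, IsFactor (u ^ k) w → u = 1

/-- A morphism is `k`-powerfree if it maps `k`-powerfree words to `k`-powerfree words. -/
def IsPowerfreeMorphism (k : ℕ) (ρ : FreeMonoid A →* FreeMonoid B) : Prop :=
  ∀ w : FreeMonoid A, IsPowerfree k w → IsPowerfree k (ρ w)

/-- A morphism is `l`-uniform if the image of every letter has length `l`. -/
def IsUniform (l : ℕ) (ρ : FreeMonoid A →* FreeMonoid B) : Prop :=
  ∀ a : A, (ρ (FreeMonoid.of a)).length = l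

/-- The number of occurrences of the letter `a` in the finite word `w`. -/
def letterCount [DecidableEq A] (a : A) (w : FreeMonoid A) : ℕ :=
  w.toList.count a

/-- The substitution matrix: its entry `(i, j)` is the number of letters `i` in the image of
the letter `j`. -/
def substitutionMatrix [DecidableEq A] (ρ : FreeMonoid A →* FreeMonoid A) : Matrix A A ℕ :=
  Matrix.of fun i j => letterCount i (ρ (FreeMonoid.of j))

/-- The factor `w i, w (i + 1), …, w (i + n - 1)` of the infinite word `w`. -/
def block (w : ℕ → A) (i n : ℕ) : FreeMonoid A :=
  FreeMonoid.ofList (List.ofFn fun j : Fin n => w (i + j))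

/-- `v` is a (finite) factor of the infinite word `w`. -/
def IsFactorOfInfinite (v : FreeMonoid A) (w : ℕ → A) : Prop :=
  ∃ i : ℕ, v = block w i v.length

/-- `v` is a (finite) prefix of the infinite word `w`. -/
def IsPrefixOfInfinite (v : FreeMonoid A) (w : ℕ → A) : Prop :=
  v = block w 0 v.length

/-- An infinite word is `k`-powerfree if none of its factors is a `k`-power `u ^ k` of a
nonempty word `u`. -/
def IsPowerfreeInfinite (k : ℕ) (w : ℕ → A) : Prop :=
  ∀ u : FreeMonoid A, IsFactorOfInfinite (u ^ k) w → u = 1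

/-- The infinite word `v` is the image of the infinite word `w` under the morphism `ρ`: the images
of the prefixes of `w` are prefixes of `v`, of unbounded length. -/
def IsImageInfinite (ρ : FreeMonoid A →* FreeMonoid B) (w : ℕ → A) (v : ℕ → B) : Prop :=
  (∀ n : ℕ, IsPrefixOfInfinite (ρ (block w 0 n)) v) ∧
    ∀ m : ℕ, ∃ n : ℕ, m ≤ (ρ (block w 0 n)).length

/-- The infinite word `w` is a fixed point of the morphism `ρ`. -/
def IsFixedPoint (ρ : FreeMonoid A →* FreeMonoid A) (w : ℕ → A) : Prop :=
  IsImageInfinite ρ w w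

/-- The sequences whose `n`-th term is a factor of length `n` of the infinite word `w`. -/
def FactorSeq (w : ℕ → A) : Type _ :=
  {s : ℕ → FreeMonoid A // ∀ n, (s n).length = n ∧ IsFactorOfInfinite (s n) w}

/-- The upper frequency of the letter `a` in the infinite word `w`. -/
noncomputable def upperFrequency [DecidableEq A] (w : ℕ → A) (a : A) : ℝ :=
  ⨆ s : FactorSeq w, limsup (fun n : ℕ => (letterCount a (s.1 n) : ℝ) / n) atTop

/-- The lower frequency of the letter `a` in the infinite word `w`. -/
noncomputable def lowerFrequency [DecidableEq A] (w : ℕ → A) (a : A) : ℝ :=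
  ⨅ s : FactorSeq w, liminf (fun n : ℕ => (letterCount a (s.1 n) : ℝ) / n) atTop

/-- The letter `a` has the (well-defined) frequency `f` in the infinite word `w`. -/
def HasFrequency [DecidableEq A] (w : ℕ → A) (a : A) (f : ℝ) : Prop :=
  upperFrequency w a = f ∧ lowerFrequency w a = f

/-- The frequencies of the letter `0` in the infinite cubefree binary words in which this letter
has a well-defined frequency. -/
def cubefreeFrequencies : Set ℝ :=
  {f | ∃ w : ℕ → Fin 2, IsPowerfreeInfinite 3 w ∧ HasFrequency w 0 f}

/-- The minimal letter frequency in infinite binary cubefree words. -/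
noncomputable def fMin : ℝ :=
  sInf cubefreeFrequencies

/-- The images of the two letters under the morphism of length 27. -/
def rho27Letter : Fin 2 → FreeMonoid (Fin 2) :=
  ![FreeMonoid.ofList [0,1,1,0,1,1,0,1,0,1,1,0,1,1,0,0,1,1,0,1,1,0,1,0,1,1,0],
    FreeMonoid.ofList [0,1,1,0,1,1,0,1,0,1,1,0,1,1,0,0,1,1,0,1,0,1,1,0,1,1,0]]

/-- The binary morphism `0 ↦ 011011010110110011011010110`, `1 ↦ 011011010110110011010110110`. -/
def rho27 : FreeMonoid (Fin 2) →* FreeMonoid (Fin 2) :=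
  FreeMonoid.lift rho27Letter

end PowerfreeWords

namespace PowerfreeWords

/-! ### Factors of infinite words and cubes as periodicity conditions on positions -/

section Blocks

variable {A : Type*}

/-! Everything rests on desubstituting cubes (`HasCubeAt.of_rho27Image`). In an image under `rho27`,
periods below 14 are excluded by a finite check. A longer cube compares letters at distance p in
every residue class mod 27, and the two images are synchronizing, so 27 divides p. One column that
distinguishes the images then gives a cube in the preimage. Applied to finite words this makes the
morphism cubefree; iterated on the fixed point it is an infinite descent.

For the frequencies, both images contain equally many letters of each kind, so prefix counts deviate
from linear growth by a bounded amount. Hence 11/27 is attained by a cubefree word. -/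

@[simp] theorem length_block (w : ℕ → A) (i n : ℕ) : (block w i n).length = n :=
  List.length_ofFn

theorem toList_block (w : ℕ → A) (i n : ℕ) :
    (block w i n).toList = List.ofFn fun j : Fin n => w (i + j) := rfl

theorem block_eq_block_iff {v w : ℕ → A} {i k n : ℕ} :
    block v i n = block w k n ↔ ∀ j < n, v (i + j) = w (k + j) := by
  rw [← FreeMonoid.toList.apply_eq_iff_eq, toList_block, toList_block, List.ofFn_inj, funext_iff]
  exact ⟨fun h j hj => h ⟨j, hj⟩, fun h j => h j j.2⟩

theorem block_add (w : ℕ → A) (i m n : ℕ) :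
    block w i (m + n) = block w i m * block w (i + m) n := by
  apply FreeMonoid.toList.injective
  rw [FreeMonoid.toList_mul, toList_block, toList_block, toList_block, List.ofFn_add]
  simp [add_assoc]

theorem exists_eq_block [Inhabited A] (u : FreeMonoid A) :
    ∃ w : ℕ → A, u = block w 0 u.length := by
  refine ⟨fun n => u.toList.getD n default, ?_⟩
  apply FreeMonoid.toList.injective
  rw [toList_block]
  apply List.ext_getElem
  · rw [List.length_ofFn]; rfl
  · intro n h₁ h₂
    simp [h₁]

theorem isFactor_block_iff {w : ℕ → A} {n : ℕ} {v : FreeMonoid A} :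
    IsFactor v (block w 0 n) ↔ ∃ i, i + v.length ≤ n ∧ v = block w i v.length := by
  constructor
  · rintro ⟨x, y, h⟩
    have hn : n = x.length + v.length + y.length := by
      have := congrArg FreeMonoid.length h
      simpa [FreeMonoid.length_mul] using this
    refine ⟨x.length, by omega, ?_⟩
    rw [hn, block_add, block_add, zero_add] at h
    have h' := congrArg FreeMonoid.toList h
    simp only [FreeMonoid.toList_mul] at h'
    have h₁ := (List.append_inj h' (by
      rw [List.length_append, List.length_append]
      simp only [toList_block, List.length_ofFn]; rfl)).1
    have h₂ := (List.append_inj h₁ (by simp only [toList_block, List.length_ofFn]; rfl)).2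
    exact (FreeMonoid.toList.injective h₂).symm
  · rintro ⟨i, hi, hv⟩
    obtain ⟨k, rfl⟩ := Nat.exists_eq_add_of_le hi
    refine ⟨block w 0 i, block w (i + v.length) k, ?_⟩
    rw [block_add, block_add, zero_add, zero_add, ← hv]

/-- The infinite word `w` has a cube with period `p` starting at position `i`. -/
def HasCubeAt (w : ℕ → A) (i p : ℕ) : Prop :=
  ∀ j < 2 * p, w (i + j) = w (i + j + p)

theorem HasCubeAt.block_eq {w : ℕ → A} {i p : ℕ} (h : HasCubeAt w i p) :
    block w i p ^ 3 = block w i (3 * p) := by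
  have h₁ : block w (i + p) p = block w i p :=
    block_eq_block_iff.2 fun j hj => by
      rw [h j (by omega)]; congr 1; omega
  have h₂ : block w (i + 2 * p) p = block w i p := by
    rw [← h₁]
    refine block_eq_block_iff.2 fun j hj => ?_
    have := h (p + j) (by omega)
    rw [show i + p + j = i + (p + j) by omega, this]; congr 1; omega
  rw [show 3 * p = p + p + p by omega, block_add, block_add, h₁,
    show i + (p + p) = i + 2 * p by omega, h₂, pow_succ, pow_two]

theorem hasCubeAt_of_block_eq {w : ℕ → A} {i : ℕ} {u : FreeMonoid A}
    (h : u ^ 3 = block w i (u ^ 3).length) : HasCubeAt w i u.length := by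
  have hl : (u ^ 3).length = u.length + u.length + u.length := by
    simp [pow_succ, FreeMonoid.length_mul]
  rw [hl, block_add, block_add, pow_succ, pow_two] at h
  have h' := congrArg FreeMonoid.toList h
  simp only [FreeMonoid.toList_mul] at h'
  have hu (k : ℕ) : u.toList.length = (block w k u.length).toList.length := by
    rw [toList_block, List.length_ofFn]; rfl
  have h₁ := List.append_inj h' (by simp only [List.length_append, ← hu])
  have h₂ := List.append_inj h₁.1 (hu _)
  have e₁ := FreeMonoid.toList.injective (h₂.1.symm.trans h₂.2)
  have e₂ := FreeMonoid.toList.injective (h₂.1.symm.trans h₁.2)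
  rw [block_eq_block_iff] at e₁ e₂
  intro j hj
  by_cases hjp : j < u.length
  · rw [e₁ j hjp]; congr 1; omega
  · have a₁ := e₁ (j - u.length) (by omega)
    have a₂ := e₂ (j - u.length) (by omega)
    rw [show i + u.length + (j - u.length) = i + j by omega] at a₁
    rw [show i + (u.length + u.length) + (j - u.length) = i + j + u.length by omega] at a₂
    exact a₁.symm.trans a₂

theorem length_cube (u : FreeMonoid A) : (u ^ 3).length = 3 * u.length := by
  simp only [pow_succ, pow_zero, one_mul, FreeMonoid.length_mul]; omega

theorem isPowerfree_three_block_iff {w : ℕ → A} {n : ℕ} :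
    IsPowerfree 3 (block w 0 n) ↔ ∀ i p, 0 < p → i + 3 * p ≤ n → ¬ HasCubeAt w i p := by
  constructor
  · intro h i p hp hn hc
    have := h (block w i p) (isFactor_block_iff.2 ⟨i, by rwa [length_cube, length_block],
      by rw [length_cube, length_block, hc.block_eq]⟩)
    have := congrArg FreeMonoid.length this
    rw [length_block, FreeMonoid.length_one] at this
    omega
  · intro h u hu
    obtain ⟨i, hi, he⟩ := isFactor_block_iff.1 hu
    by_contra hne
    refine h i u.length (Nat.pos_of_ne_zero fun h0 => hne (FreeMonoid.length_eq_zero.1 h0)) ?_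
      (hasCubeAt_of_block_eq he)
    rwa [← length_cube]

theorem isPowerfreeInfinite_three_of_forall {w : ℕ → A}
    (h : ∀ i p, 0 < p → ¬ HasCubeAt w i p) : IsPowerfreeInfinite 3 w := by
  rintro u ⟨i, he⟩
  by_contra hne
  exact h i u.length (Nat.pos_of_ne_zero fun h0 => hne (FreeMonoid.length_eq_zero.1 h0))
    (hasCubeAt_of_block_eq he)

end Blocks

/-! ### Cubefreeness of the morphism -/

section Morphism

/-- The letter at position `r` of the image of `a` under `rho27`. -/
def rho27Entry (a : Fin 2) (r : ℕ) : Fin 2 :=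
  (rho27Letter a).toList.getD r 0

/-- The image of an infinite word under `rho27`, letter by letter. -/
def rho27Image (w : ℕ → Fin 2) (m : ℕ) : Fin 2 :=
  rho27Entry (w (m / 27)) (m % 27)

theorem rho27_of (a : Fin 2) : rho27 (FreeMonoid.of a) = rho27Letter a :=
  FreeMonoid.lift_eval_of _ _

theorem isUniform_rho27 : IsUniform 27 rho27 := by
  intro a
  rw [rho27_of]
  revert a
  decide

theorem substitutionMatrix_rho27 : substitutionMatrix rho27 = !![11, 11; 16, 16] := by
  ext i j
  rw [substitutionMatrix, Matrix.of_apply, rho27_of]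
  fin_cases i <;> fin_cases j <;> rfl

theorem rho27Letter_eq_block (a : Fin 2) : rho27Letter a = block (rho27Entry a) 0 27 := by
  apply FreeMonoid.toList.injective
  fin_cases a <;> rfl

theorem rho27_block (w : ℕ → Fin 2) (n : ℕ) :
    rho27 (block w 0 n) = block (rho27Image w) 0 (27 * n) := by
  induction n with
  | zero => rfl
  | succ n ih =>
    have hs : block w (0 + n) 1 = FreeMonoid.of (w n) := by
      apply FreeMonoid.toList.injective
      simp [toList_block]
    rw [block_add, map_mul, ih, mul_add, block_add, hs, rho27_of, rho27Letter_eq_block]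
    congr 1
    refine block_eq_block_iff.2 fun j hj => ?_
    simp only [rho27Image]
    rw [show (0 + 27 * n + j) / 27 = n by omega, show (0 + 27 * n + j) % 27 = 0 + j by omega]

/-- The column r depends only on the shift d, not on the letters, so one comparison refutes a
misaligned period. -/
theorem rho27Entry_synchronizing : ∀ d < 27, d ≠ 0 →
    ∃ r < 27, ∀ a b, rho27Entry a r ≠ rho27Entry b ((r + d) % 27) := by
  decide +kernel

theorem rho27Entry_twenty : ∀ a b, rho27Entry a 20 = rho27Entry b 20 → a = b := by
  decide

/-- The letter at position `k` of the image of the word `abc` under `rho27`. -/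
def rho27Triple (a b c : Fin 2) (k : ℕ) : Fin 2 :=
  rho27Entry (if k < 27 then a else if k < 54 then b else c) (k % 27)

/-- Three images suffice: such a cube ends before position 26 + 3 · 13 = 65 < 81. -/
theorem rho27Triple_no_short_cube : ∀ a b c, ∀ p < 14, 0 < p → ∀ i < 27,
    ∃ j < 2 * p, rho27Triple a b c (i + j) ≠ rho27Triple a b c (i + j + p) := by
  decide +kernel

theorem not_hasCubeAt_rho27Image_of_lt {w : ℕ → Fin 2} {i p : ℕ} (hp : 0 < p) (hp' : p < 14) :
    ¬ HasCubeAt (rho27Image w) i p := by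
  intro h
  obtain ⟨j, hj, hne⟩ := rho27Triple_no_short_cube (w (i / 27)) (w (i / 27 + 1))
    (w (i / 27 + 2)) p hp' hp (i % 27) (Nat.mod_lt _ (by omega))
  have key (k : ℕ) (hk : k < 54) : rho27Image w (i + k) =
      rho27Triple (w (i / 27)) (w (i / 27 + 1)) (w (i / 27 + 2)) (i % 27 + k) := by
    rw [rho27Image, rho27Triple, show (i % 27 + k) % 27 = (i + k) % 27 by omega]
    congr 1
    split_ifs with h₁ h₂ <;> congr 1 <;> omega
  have := h j hj
  rw [key j (by omega), add_assoc, key (j + p) (by omega), ← add_assoc] at this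
  exact hne this

theorem HasCubeAt.dvd_period {w : ℕ → Fin 2} {i p : ℕ} (hp : 14 ≤ p)
    (h : HasCubeAt (rho27Image w) i p) : 27 ∣ p := by
  by_contra hd
  obtain ⟨r, hr, hne⟩ := rho27Entry_synchronizing (p % 27) (Nat.mod_lt _ (by omega)) (by omega)
  -- The least offset reaching column r; it is at most 26, below 2p because p ≥ 14.
  have := h ((r + 27 - i % 27) % 27) (by omega)
  simp only [rho27Image] at this
  rw [show (i + (r + 27 - i % 27) % 27) % 27 = r by omega,
    show (i + (r + 27 - i % 27) % 27 + p) % 27 = (r + p % 27) % 27 by omega] at this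
  exact hne _ _ this

/-- A cube in the image of `w` under `rho27` comes from a cube in `w`. -/
theorem HasCubeAt.of_rho27Image {w : ℕ → Fin 2} {i p n : ℕ} (hp : 0 < p)
    (hn : i + 3 * p ≤ 27 * n) (h : HasCubeAt (rho27Image w) i p) :
    ∃ k q, 0 < q ∧ k + 3 * q ≤ n ∧ HasCubeAt w k q := by
  by_cases hp' : p < 14
  · exact (not_hasCubeAt_rho27Image_of_lt hp hp' h).elim
  obtain ⟨q, rfl⟩ := h.dvd_period (by omega)
  -- This is the first image whose column 20, where the images first differ, lies at or after i.
  refine ⟨(i + 6) / 27, q, by omega, by omega, fun j hj => ?_⟩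
  have := h (27 * ((i + 6) / 27 + j) + 20 - i) (by omega)
  rw [show i + (27 * ((i + 6) / 27 + j) + 20 - i) = 27 * ((i + 6) / 27 + j) + 20 by omega] at this
  simp only [rho27Image] at this
  rw [show (27 * ((i + 6) / 27 + j) + 20) / 27 = (i + 6) / 27 + j by omega,
    show (27 * ((i + 6) / 27 + j) + 20) % 27 = 20 by omega,
    show (27 * ((i + 6) / 27 + j) + 20 + 27 * q) / 27 = (i + 6) / 27 + j + q by omega,
    show (27 * ((i + 6) / 27 + j) + 20 + 27 * q) % 27 = 20 by omega] at this
  exact rho27Entry_twenty _ _ this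

theorem isPowerfreeMorphism_rho27 : IsPowerfreeMorphism 3 rho27 := by
  intro u hu
  obtain ⟨w, hw⟩ := exists_eq_block u
  rw [hw, isPowerfree_three_block_iff] at hu
  rw [hw, rho27_block, isPowerfree_three_block_iff]
  intro i p hp hn hc
  obtain ⟨k, q, hq, hkq, hc'⟩ := hc.of_rho27Image hp hn
  exact hu k q hq hkq hc'

end Morphism

/-! ### The fixed point and its cubefreeness -/

section FixedPoint

theorem isFixedPoint_rho27_iff {w : ℕ → Fin 2} : IsFixedPoint rho27 w ↔ rho27Image w = w := by
  constructor
  · rintro ⟨h, -⟩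
    funext m
    have := h (m + 1)
    rw [rho27_block, IsPrefixOfInfinite, length_block, block_eq_block_iff] at this
    simpa using this m (by omega)
  · intro h
    refine ⟨fun n => ?_, fun m => ⟨m, ?_⟩⟩
    · rw [rho27_block, h, IsPrefixOfInfinite, length_block]
    · rw [rho27_block, length_block]; omega

/-- The infinite fixed point of `rho27`. -/
def rho27Word : ℕ → Fin 2
  | 0 => 0
  | m + 1 => rho27Entry (rho27Word ((m + 1) / 27)) ((m + 1) % 27)
decreasing_by omega

theorem rho27Entry_zero : ∀ a, rho27Entry a 0 = 0 := by
  decide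

theorem rho27Image_rho27Word : rho27Image rho27Word = rho27Word := by
  funext m
  cases m with
  | zero => rw [rho27Image, Nat.zero_mod, rho27Entry_zero, rho27Word]
  | succ m => rw [rho27Image, ← rho27Word]

/-- Both images begin with 0, and every later letter is determined by an earlier one. -/
theorem eq_rho27Word {v : ℕ → Fin 2} (h : rho27Image v = v) : v = rho27Word := by
  funext m
  induction m using Nat.strong_induction_on with
  | _ m ih =>
    rw [← congrFun h m, ← congrFun rho27Image_rho27Word m]
    rcases Nat.eq_zero_or_pos m with rfl | hm
    · simp only [rho27Image, Nat.zero_mod, rho27Entry_zero]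
    · rw [rho27Image, rho27Image, ih (m / 27) (by omega)]

theorem rho27_iterate_of_zero (n : ℕ) :
    rho27^[n] (FreeMonoid.of 0) = block rho27Word 0 (27 ^ n) := by
  induction n with
  | zero =>
    apply FreeMonoid.toList.injective
    simp [toList_block, rho27Word]
  | succ n ih =>
    rw [Function.iterate_succ_apply', ih, rho27_block, rho27Image_rho27Word, pow_succ']

theorem not_hasCubeAt_rho27Word (n : ℕ) : ∀ i p, 0 < p → i + 3 * p ≤ n →
    ¬ HasCubeAt rho27Word i p := by
  induction n using Nat.strong_induction_on with
  | _ n ih =>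
    intro i p hp hn hc
    rw [← rho27Image_rho27Word] at hc
    -- The bound becomes n/27 rounded up, which is smaller than n since n ≥ 3.
    obtain ⟨k, q, hq, hkq, hc'⟩ := hc.of_rho27Image (n := (n + 26) / 27) hp (by omega)
    exact ih _ (by omega) k q hq hkq hc'

theorem isPowerfreeInfinite_rho27Word : IsPowerfreeInfinite 3 rho27Word :=
  isPowerfreeInfinite_three_of_forall fun i p hp =>
    not_hasCubeAt_rho27Word (i + 3 * p) i p hp le_rfl

end FixedPoint

/-! ### Letter frequencies -/

section Frequency

variable {A : Type*} [DecidableEq A]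

theorem letterCount_mul (a : A) (u v : FreeMonoid A) :
    letterCount a (u * v) = letterCount a u + letterCount a v := by
  rw [letterCount, FreeMonoid.toList_mul, List.count_append]; rfl

theorem letterCount_le_length (a : A) (u : FreeMonoid A) : letterCount a u ≤ u.length :=
  List.count_le_length

instance (w : ℕ → A) : Nonempty (FactorSeq w) :=
  ⟨⟨fun n => block w 0 n, fun n => ⟨length_block w 0 n, 0, by rw [length_block]⟩⟩⟩

theorem hasFrequency_of_bounded_discrepancy {w : ℕ → A} {a : A} {f C : ℝ}
    (h : ∀ i n, |(letterCount a (block w i n) : ℝ) - f * n| ≤ C) : HasFrequency w a f := by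
  have key (s : FactorSeq w) :
      Tendsto (fun n : ℕ => (letterCount a (s.1 n) : ℝ) / n) atTop (nhds f) := by
    rw [tendsto_iff_norm_sub_tendsto_zero]
    refine squeeze_zero' (.of_forall fun n => norm_nonneg _) ?_
      (tendsto_const_div_atTop_nhds_zero_nat C)
    filter_upwards [eventually_gt_atTop 0] with n hn
    have hn' : (0 : ℝ) < n := by exact_mod_cast hn
    obtain ⟨hl, i, hi⟩ := s.2 n
    rw [hl] at hi
    rw [hi, Real.norm_eq_abs, le_div_iff₀ hn', ← abs_of_pos hn', ← abs_mul, abs_of_pos hn',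
      sub_mul, div_mul_cancel₀ _ hn'.ne']
    exact h i n
  constructor
  · simp only [upperFrequency, (key _).limsup_eq, ciSup_const]
  · simp only [lowerFrequency, (key _).liminf_eq, ciInf_const]

theorem hasFrequency_of_prefix_discrepancy {w : ℕ → A} {a : A} {f C : ℝ}
    (h : ∀ n, |(letterCount a (block w 0 n) : ℝ) - f * n| ≤ C) : HasFrequency w a f := by
  refine hasFrequency_of_bounded_discrepancy (C := 2 * C) fun i n => ?_
  have h₁ := abs_le.1 (h i)
  have h₂ := abs_le.1 (h (i + n))
  rw [block_add, letterCount_mul, zero_add] at h₂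
  push_cast at h₂
  rw [abs_le]
  constructor <;> linarith [h₁.1, h₁.2, h₂.1, h₂.2]

theorem lowerFrequency_nonneg (w : ℕ → A) (a : A) : 0 ≤ lowerFrequency w a := by
  refine Real.iInf_nonneg fun s => le_liminf_of_le ?_ (.of_forall fun n => by positivity)
  -- A real `liminf` is only meaningful with this upper bound on the ratios.
  refine IsBoundedUnder.isCoboundedUnder_ge ⟨1, eventually_map.2 (.of_forall fun n => ?_)⟩
  refine div_le_one_of_le₀ ?_ (Nat.cast_nonneg n)
  exact_mod_cast (letterCount_le_length a (s.1 n)).trans (s.2 n).1.le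

/-- Complete images contribute exactly c each; only the last, partial image causes an error, at most
27. -/
theorem hasFrequency_rho27Image {a : Fin 2} {c : ℕ} (hc : ∀ b, letterCount a (rho27Letter b) = c)
    (w : ℕ → Fin 2) : HasFrequency (rho27Image w) a (c / 27) := by
  have hc27 : c ≤ 27 :=
    hc 0 ▸ (letterCount_le_length a _).trans ((rho27_of 0 ▸ isUniform_rho27 0).le)
  have hb (q : ℕ) : letterCount a (rho27 (block w 0 q)) = c * q := by
    induction q with
    | zero => rfl
    | succ q ih =>
      have hs : block w (0 + q) 1 = FreeMonoid.of (w q) := by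
        apply FreeMonoid.toList.injective
        simp [toList_block]
      rw [block_add, map_mul, letterCount_mul, ih, hs, rho27_of, hc, mul_add, mul_one]
  refine hasFrequency_of_prefix_discrepancy (C := 27) fun n => ?_
  have hn := Nat.div_add_mod n 27
  have hr := Nat.mod_lt n (show 0 < 27 by omega)
  set q := n / 27
  set r := n % 27
  rw [← hn, block_add, letterCount_mul, ← rho27_block, hb]
  have hle := (letterCount_le_length a (block (rho27Image w) (0 + 27 * q) r)).trans_eq
    (length_block _ _ _)
  have h₁ : (letterCount a (block (rho27Image w) (0 + 27 * q) r) : ℝ) ≤ r := by exact_mod_cast hle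
  have h₂ : (r : ℝ) ≤ 27 := by exact_mod_cast hr.le
  have h₃ : (c : ℝ) / 27 * r ≤ r :=
    mul_le_of_le_one_left (Nat.cast_nonneg _)
      ((div_le_one (by norm_num)).2 (by exact_mod_cast hc27))
  have h₄ : (0 : ℝ) ≤ (c : ℝ) / 27 * r := by positivity
  have h₅ : (0 : ℝ) ≤ letterCount a (block (rho27Image w) (0 + 27 * q) r) := Nat.cast_nonneg _
  push_cast
  rw [show (c : ℝ) * q + letterCount a (block (rho27Image w) (0 + 27 * q) r) -
    c / 27 * (27 * q + r) = letterCount a (block (rho27Image w) (0 + 27 * q) r) - c / 27 * r by ring,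
    abs_le]
  constructor <;> linarith

theorem hasFrequency_rho27Word_zero : HasFrequency rho27Word 0 (11 / 27) := by
  have := hasFrequency_rho27Image (a := 0) (c := 11) (by decide) rho27Word
  rw [rho27Image_rho27Word] at this
  exact_mod_cast this

theorem hasFrequency_rho27Word_one : HasFrequency rho27Word 1 (16 / 27) := by
  have := hasFrequency_rho27Image (a := 1) (c := 16) (by decide) rho27Word
  rw [rho27Image_rho27Word] at this
  exact_mod_cast this

theorem mem_cubefreeFrequencies : (11 / 27 : ℝ) ∈ cubefreeFrequencies :=
  ⟨rho27Word, isPowerfreeInfinite_rho27Word, hasFrequency_rho27Word_zero⟩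

theorem isGLB_fMin : IsGLB cubefreeFrequencies fMin := by
  refine isGLB_csInf ⟨_, mem_cubefreeFrequencies⟩ ⟨0, ?_⟩
  rintro f ⟨w, -, -, rfl⟩
  exact lowerFrequency_nonneg w 0

end Frequency

end PowerfreeWords

theorem mainTheorem5 :
    PowerfreeWords.IsUniform 27 PowerfreeWords.rho27 ∧
    PowerfreeWords.IsPowerfreeMorphism 3 PowerfreeWords.rho27 ∧
    PowerfreeWords.substitutionMatrix PowerfreeWords.rho27 = !![11, 11; 16, 16] ∧
    (∃ w : ℕ → Fin 2,
      (∀ v : ℕ → Fin 2, PowerfreeWords.IsFixedPoint PowerfreeWords.rho27 v ↔ v = w) ∧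
      (∀ n : ℕ, PowerfreeWords.IsPrefixOfInfinite
        ((PowerfreeWords.rho27)^[n] (FreeMonoid.of 0)) w) ∧
      PowerfreeWords.IsPowerfreeInfinite 3 w ∧
      PowerfreeWords.HasFrequency w 0 (11 / 27) ∧
      PowerfreeWords.HasFrequency w 1 (16 / 27)) ∧
    IsGLB PowerfreeWords.cubefreeFrequencies PowerfreeWords.fMin ∧
    PowerfreeWords.fMin ≤ 11 / 27 := by
  open PowerfreeWords in
  refine ⟨isUniform_rho27, isPowerfreeMorphism_rho27, substitutionMatrix_rho27,
    ⟨rho27Word, fun v => ?_, fun n => ?_, isPowerfreeInfinite_rho27Word,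
      hasFrequency_rho27Word_zero, hasFrequency_rho27Word_one⟩,
    isGLB_fMin, isGLB_fMin.1 mem_cubefreeFrequencies⟩
  · rw [isFixedPoint_rho27_iff]
    exact ⟨eq_rho27Word, fun h => h ▸ rho27Image_rho27Word⟩
  · rw [rho27_iterate_of_zero, IsPrefixOfInfinite, length_block]
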